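/- Let $\mathbb{B}$ be the open unit ball of $\mathbb{C}^{2\times 2}$ in the operator norm, let $\pi(A)=(a_{21},\operatorname{tr}A,\det A)$ for $A=[a_{ij}]\in\mathbb{C}^{2\times 2}$, and let $\mathcal{P}=\pi(\mathbb{B})\subset\mathbb{C}^3$ be the pentablock, with closure $\bar{\mathcal{P}}$. Let $\mathbb{G}=\{(z+w,zw): |z|<1,\ |w|<1\}\subset\mathbb{C}^2$ be the open symmetrised bidisc, with closure $\Gamma$. For a domain $\Omega\subset\mathbb{C}^n$ let $A(\Omega)$ be the algebra of continuous complex-valued functions on $\bar\Omega$ that are holomorphic on $\Omega$. A boundary for $\Omega$ is a set $C\subset\bar\Omega$ such that every $f\in A(\Omega)$ attains its maximum modulus over $\bar\Omega$ at a point of $C$; the distinguished (Shilov) boundary of $\Omega$ is the smallest closed boundary for $\Omega$ (the one contained in all the closed boundaries for $\Omega$), when it exists. A peak point of $\bar\Omega$ is a point $u\in\bar\Omega$ for which there is $g\in A(\Omega)$ with $g(u)=1$ and $|g(x)|<1$ for all $x\in\bar\Omega\setminus\{u\}$. **Theorem.** The distinguished boundary $b\Gamma$ of $\mathbb{G}$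 exists and is the symmetrised torus, $b\Gamma=\{(z_1+z_2,z_1z_2): |z_1|=|z_2|=1\}$. The distinguished boundary $b\mathcal{P}$ of $\mathcal{P}$ also exists. With $$K_0=\Big\{(a,s,p)\in\mathbb{C}^3: (s,p)\in b\Gamma,\ |a|=\sqrt{1-\tfrac14|s|^2}\Big\},$$ the following are equivalent for $x\in\mathbb{C}^3$: 1. $x\in K_0$; 2. $x$ is a peak point of $\bar{\mathcal{P}}$; 3. $x\in b\mathcal{P}$. Therefore $$b\mathcal{P}=\Big\{(a,s,p)\in\mathbb{C}^3: (s,p)\in b\Gamma,\ |a|=\sqrt{1-\tfrac14|s|^2}\Big\},$$ and so $$b\mathcal{P}=\Big\{(a,s,p)\in\mathbb{C}^3: |s|\le 2,\ |p|=1,\ s=\bar s p,\ |a|=\sqrt{1-\tfrac14|s|^2}\Big\}.$$ -/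

import Mathlib

open Matrix

section

/-- The open unit ball `𝔹` of the space of `2 × 2` complex matrices, with respect to the operator
norm induced by the Euclidean norm of `ℂ²`. -/
def matrixBall : Set (Matrix (Fin 2) (Fin 2) ℂ) :=
  {A | ‖Matrix.toEuclideanCLM (n := Fin 2) (𝕜 := ℂ) A‖ < 1}

/-- The polynomial map `π(A) = (a₂₁, tr A, det A)`. -/
def pentaMap (A : Matrix (Fin 2) (Fin 2) ℂ) : ℂ × ℂ × ℂ :=
  (A 1 0, A.trace, A.det)

/-- The pentablock `𝒫 = π(𝔹)`. -/
def pentablock : Set (ℂ × ℂ × ℂ) :=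
  pentaMap '' matrixBall

/-- The open symmetrised bidisc `𝔾 = {(z + w, zw) : |z| < 1, |w| < 1}`; its closure is `Γ`. -/
def symBidisc : Set (ℂ × ℂ) :=
  {x | ∃ z w : ℂ, ‖z‖ < 1 ∧ ‖w‖ < 1 ∧ x = (z + w, z * w)}

/-- The symmetrised torus `{(z₁ + z₂, z₁z₂) : |z₁| = |z₂| = 1}`. -/
def symTorus : Set (ℂ × ℂ) :=
  {x | ∃ z w : ℂ, ‖z‖ = 1 ∧ ‖w‖ = 1 ∧ x = (z + w, z * w)}

end

section

variable {E : Type*} [NormedAddCommGroup E] [NormedSpace ℂ E]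

/-- The algebra `A(Ω)` of functions continuous on the closure of `Ω` and holomorphic on `Ω`.
Elements are represented by total functions, whose values off the closure of `Ω` are irrelevant. -/
def discAlgebra (Ω : Set E) : Set (E → ℂ) :=
  {f | ContinuousOn f (closure Ω) ∧ DifferentiableOn ℂ f Ω}

/-- `C` is a boundary for `Ω`: it is contained in the closure of `Ω`, and every function in `A(Ω)`
attains its maximum modulus over the closure of `Ω` at a point of `C`. -/
def IsBoundaryFor (Ω C : Set E) : Prop :=
  C ⊆ closure Ω ∧ ∀ f ∈ discAlgebra Ω, ∃ c ∈ C, ∀ x ∈ closure Ω, ‖f x‖ ≤ ‖f c‖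

/-- The collection of all closed boundaries for `Ω`. -/
def closedBoundaries (Ω : Set E) : Set (Set E) :=
  {C | IsClosed C ∧ IsBoundaryFor Ω C}

/-- The intersection of all closed boundaries for `Ω`. If a smallest closed boundary exists, this
is the smallest closed boundary, i.e. the distinguished (Shilov) boundary `bΩ`. -/
def distinguishedBoundary (Ω : Set E) : Set E :=
  ⋂₀ closedBoundaries Ω

/-- `u` is a peak point of the closure of `Ω`, with respect to the algebra `A(Ω)`. -/
def IsPeakPoint (Ω : Set E) (u : E) : Prop :=
  u ∈ closure Ω ∧ ∃ g ∈ discAlgebra Ω, g u = 1 ∧ ∀ x ∈ closure Ω \ {u}, ‖g x‖ < 1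

end

/-- `K₀ = {(a, s, p) : (s, p) ∈ bΓ, |a| = √(1 - |s|²/4)}`, where `bΓ` is the distinguished boundary
of the symmetrised bidisc. -/
def pentaK₀ : Set (ℂ × ℂ × ℂ) :=
  {x | (x.2.1, x.2.2) ∈ distinguishedBoundary symBidisc ∧
    ‖x.1‖ = Real.sqrt (1 - (1 / 4) * ‖x.2.1‖ ^ 2)}

open Set Metric Filter Topology

/-! ### Peak points and closed boundaries. -/

section Boundary

variable {E : Type*} [NormedAddCommGroup E] [NormedSpace ℂ E] {Ω K : Set E}

/-! A peak point lies in every boundary, so a closed boundary made of peak points is the smallest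
one. For `symTorus` and `pentaK₀` two things are needed: explicit peak functions, and the maximum
principle.

Peaking on `pentablock` is Cauchy–Schwarz for `(a, s/2)`, which lies in the unit ball of `ℂ²`, times
a factor detecting `p`. On `symBidisc` it is the estimate `norm_peak_mul_lt`.

For the maximum principle on `symBidisc`, pull `f` back to the bidisc. On `pentablock`, write an
invertible contraction as `U * diagonal ![z, w] * V`; letting `z, w` vary over the bidisc bounds `f`
by its values at unitaries (`norm_le_of_det_ne_zero`). A unitary gives `(s, p)` in `symTorus` and
`|a| ≤ √(1 - |s|²/4)`; the disc of all such `a` lies in the closure, and its rim in `pentaK₀`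
(`norm_le_of_unitary`). As `f` is only continuous on that disc, the disc is approximated by discs
inside the domain. -/

lemma IsPeakPoint.mem_of_isBoundaryFor {u : E} (hu : IsPeakPoint Ω u) (hK : IsBoundaryFor Ω K) :
    u ∈ K := by
  obtain ⟨hu, g, hg, hgu, hlt⟩ := hu
  obtain ⟨c, hc, hmax⟩ := hK.2 g hg
  by_cases h : c = u
  · exact h ▸ hc
  · have h1 := hlt c ⟨hK.1 hc, h⟩
    have h2 := hmax u hu
    rw [hgu, norm_one] at h2
    exact absurd h1 (not_lt.2 h2)

lemma distinguishedBoundary_eq_of_isPeakPoint (hK : K ∈ closedBoundaries Ω)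
    (hp : ∀ u ∈ K, IsPeakPoint Ω u) : distinguishedBoundary Ω = K :=
  (sInter_subset_of_mem hK).antisymm fun u hu =>
    mem_sInter.2 fun _ hC => (hp u hu).mem_of_isBoundaryFor hC.2

lemma norm_le_on_closure {S : Set E} {f : E → ℂ} (hf : f ∈ discAlgebra Ω) (hS : S ⊆ Ω)
    (hd : Ω ⊆ closure S) {M : ℝ} (hM : ∀ x ∈ S, ‖f x‖ ≤ M) : ∀ x ∈ closure Ω, ‖f x‖ ≤ M := by
  have hcl : IsClosed (closure Ω ∩ (fun x => ‖f x‖) ⁻¹' Iic M) :=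
    hf.1.norm.preimage_isClosed_of_isClosed isClosed_closure isClosed_Iic
  have h1 : closure S ⊆ closure Ω ∩ (fun x => ‖f x‖) ⁻¹' Iic M :=
    closure_minimal (fun x hx => ⟨subset_closure (hS hx), hM x hx⟩) hcl
  exact fun x hx => (h1 (closure_minimal hd isClosed_closure hx)).2

lemma mem_closedBoundaries_of_norm_le (hK : IsCompact K) (hne : K.Nonempty) (hsub : K ⊆ closure Ω)
    {S : Set E} (hS : S ⊆ Ω) (hd : Ω ⊆ closure S)
    (h : ∀ f ∈ discAlgebra Ω, ∀ M : ℝ, (∀ x ∈ K, ‖f x‖ ≤ M) → ∀ x ∈ S, ‖f x‖ ≤ M) :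
    K ∈ closedBoundaries Ω := by
  refine ⟨hK.isClosed, hsub, fun f hf => ?_⟩
  obtain ⟨c, hc, hmax⟩ := hK.exists_isMaxOn hne (hf.1.mono hsub).norm
  exact ⟨c, hc, norm_le_on_closure hf hS hd (h f hf _ fun x hx => hmax hx)⟩

end Boundary

/-! ### Maximum modulus on discs that are limits of interior discs. -/

section MaximumModulus

/-- `G (1, ·)` need not be assumed holomorphic: the maximum principle applies to `G (r, ·)` for `r <
1`, and uniform continuity lets `r → 1`. -/
lemma norm_le_of_norm_le_on_circle {G : ℝ × ℂ → ℂ}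
    (hc : ContinuousOn G (Icc 0 1 ×ˢ closedBall 0 1))
    (hd : ∀ r ∈ Ico (0 : ℝ) 1, DifferentiableOn ℂ (fun t => G (r, t)) (ball 0 1)) {M : ℝ}
    (hM : ∀ t : ℂ, ‖t‖ = 1 → ‖G (1, t)‖ ≤ M) {t : ℂ} (ht : ‖t‖ ≤ 1) : ‖G (1, t)‖ ≤ M := by
  have huc := (isCompact_Icc.prod (isCompact_closedBall (0 : ℂ) 1)).uniformContinuousOn_of_continuous
    hc
  refine le_of_forall_pos_le_add fun ε hε => ?_
  obtain ⟨δ, hδ, h⟩ := Metric.uniformContinuousOn_iff.1 huc (ε / 2) (half_pos hε)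
  -- The `max` keeps `r` nonnegative when `δ` is large.
  set r : ℝ := max 0 (1 - δ / 2) with hr
  have hr0 : 0 ≤ r := le_max_left _ _
  have hr1 : r < 1 := max_lt one_pos (by linarith)
  have hrδ : 1 - r < δ := by linarith [le_max_right 0 (1 - δ / 2)]
  have key : ∀ t : ℂ, ‖t‖ ≤ 1 → dist (G (r, t)) (G (1, t)) < ε / 2 := by
    intro t ht
    refine h _ ⟨⟨hr0, hr1.le⟩, by simpa using ht⟩ _ ⟨⟨zero_le_one, le_rfl⟩, by simpa using ht⟩ ?_
    rw [Prod.dist_eq, dist_self, Real.dist_eq, abs_sub_comm, abs_of_pos (sub_pos.2 hr1)]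
    exact max_lt hrδ hδ
  have hball : ‖G (r, t)‖ ≤ M + ε / 2 := by
    refine Complex.norm_le_of_forall_mem_frontier_norm_le (U := ball (0 : ℂ) 1)
      (f := fun t => G (r, t)) isBounded_ball ⟨hd r ⟨hr0, hr1⟩, ?_⟩ ?_ ?_
    · rw [closure_ball _ one_ne_zero]
      exact hc.comp (by fun_prop) fun t ht => ⟨⟨hr0, hr1.le⟩, ht⟩
    · intro s hs
      rw [frontier_ball _ one_ne_zero, mem_sphere_zero_iff_norm] at hs
      have h1 := key s hs.le
      rw [dist_eq_norm] at h1
      have h2 := norm_le_norm_add_norm_sub' (G (r, s)) (G (1, s))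
      linarith [hM s hs]
    · rw [closure_ball _ one_ne_zero]
      simpa using ht
  have h1 := key t ht
  rw [dist_comm, dist_eq_norm] at h1
  have h2 := norm_le_norm_add_norm_sub' (G (1, t)) (G (r, t))
  linarith

lemma norm_ofReal_mul_lt_one {r : ℝ} (hr : r ∈ Ico (0 : ℝ) 1) {z : ℂ} (hz : ‖z‖ ≤ 1) :
    ‖(r : ℂ) * z‖ < 1 := by
  rw [norm_mul, Complex.norm_of_nonneg hr.1]
  nlinarith [hr.1, hr.2, norm_nonneg z]

lemma norm_ofReal_mul_le_one {r : ℝ} (hr : r ∈ Icc (0 : ℝ) 1) {z : ℂ} (hz : ‖z‖ ≤ 1) :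
    ‖(r : ℂ) * z‖ ≤ 1 := by
  rw [norm_mul, Complex.norm_of_nonneg hr.1]
  nlinarith [hr.1, hr.2, norm_nonneg z]

/-- The maximum modulus principle for the closed bidisc and its torus. -/
lemma norm_le_of_norm_le_on_torus {g : ℂ × ℂ → ℂ}
    (hc : ContinuousOn g (closedBall 0 1 ×ˢ closedBall 0 1))
    (hd : DifferentiableOn ℂ g (ball 0 1 ×ˢ ball 0 1)) {M : ℝ}
    (hM : ∀ z w : ℂ, ‖z‖ = 1 → ‖w‖ = 1 → ‖g (z, w)‖ ≤ M) {z w : ℂ} (hz : ‖z‖ ≤ 1) (hw : ‖w‖ ≤ 1) :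
    ‖g (z, w)‖ ≤ M := by
  have h1 : ∀ z w : ℂ, ‖z‖ = 1 → ‖w‖ ≤ 1 → ‖g (z, w)‖ ≤ M := by
    intro z w hz hw
    have := norm_le_of_norm_le_on_circle (G := fun q => g (q.1 * z, q.2)) (M := M) (t := w)
      (hc.comp (by fun_prop) fun q hq =>
        ⟨by simpa using norm_ofReal_mul_le_one hq.1 hz.le, hq.2⟩)
      (fun r hr => hd.comp (by dsimp only; fun_prop) fun q hq =>
        ⟨by simpa using norm_ofReal_mul_lt_one hr hz.le, hq⟩)
      (fun t ht => by simpa using hM z t hz ht) hw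
    simpa using this
  have := norm_le_of_norm_le_on_circle (G := fun q => g (q.2, q.1 * w)) (M := M) (t := z)
    (hc.comp (by fun_prop) fun q hq =>
      ⟨hq.2, by simpa using norm_ofReal_mul_le_one hq.1 hw⟩)
    (fun r hr => hd.comp (by dsimp only; fun_prop) fun q hq =>
      ⟨hq, by simpa using norm_ofReal_mul_lt_one hr hw⟩)
    (fun t ht => by simpa using h1 t w ht hw) hz
  simpa using this

end MaximumModulus

/-! ### Estimates for peak functions. -/

section Elementary

lemma normSq_one_add_half_le {w : ℂ} (hw : ‖w‖ ≤ 1) : ‖(1 + w) / 2‖ ^ 2 ≤ (1 + w.re) / 2 := by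
  have h : ‖w‖ ^ 2 ≤ 1 := pow_le_one₀ (norm_nonneg _) hw
  rw [Complex.sq_norm, Complex.normSq_apply] at h ⊢
  simp
  nlinarith

lemma norm_one_add_half_le {w : ℂ} (hw : ‖w‖ ≤ 1) : ‖(1 + w) / 2‖ ≤ 1 := by
  have h1 := normSq_one_add_half_le hw
  have h2 := (Complex.re_le_norm w).trans hw
  exact (sq_le_one_iff₀ (norm_nonneg _)).1 (by linarith)

lemma norm_one_add_half_lt {w : ℂ} (hw : ‖w‖ ≤ 1) (hne : w ≠ 1) : ‖(1 + w) / 2‖ < 1 := by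
  have h1 := normSq_one_add_half_le hw
  have h2 : w.re < 1 := by
    refine lt_of_le_of_ne ((Complex.re_le_norm w).trans hw) fun h => hne ?_
    have h3 : ‖w‖ ^ 2 ≤ 1 := pow_le_one₀ (norm_nonneg _) hw
    rw [Complex.sq_norm, Complex.normSq_apply, h] at h3
    exact Complex.ext h (by simpa using (by nlinarith : w.im = 0))
  exact (sq_lt_one_iff₀ (norm_nonneg _)).1 (by linarith)

/-- The peaking estimate behind the peak functions of the symmetrised bidisc. -/
lemma norm_peak_mul_lt {x u : ℂ} {x₀ : ℝ} (hx₀ : |x₀| ≤ 1) (h : ‖x‖ ^ 2 + ‖u - x ^ 2‖ ≤ 1)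
    (hne : ¬ (x = x₀ ∧ u = 1)) : ‖(1 + u) / 2 * (1 - (x - x₀) ^ 2 / 4)‖ < 1 := by
  have hu : ‖u‖ ≤ 1 := by
    have := norm_le_norm_add_norm_sub' u (x ^ 2)
    rw [norm_pow] at this
    linarith
  by_cases hx : x = x₀
  · have : u ≠ 1 := fun hu => hne ⟨hx, hu⟩
    simpa [hx] using norm_one_add_half_lt hu this
  -- `Re u ≤ Re x² + 1 - |x|²`.
  have hre : u.re ≤ 1 - 2 * x.im ^ 2 := by
    have h1 := Complex.re_le_norm (u - x ^ 2)
    rw [Complex.sq_norm, Complex.normSq_apply] at h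
    simp [pow_two] at h1 h ⊢
    linarith
  have hA : ‖(1 + u) / 2‖ ^ 2 ≤ 1 - x.im ^ 2 := by linarith [normSq_one_add_half_le hu]
  have hx1 : ‖x‖ ≤ 1 := by
    refine (sq_le_one_iff₀ (norm_nonneg _)).1 ?_
    linarith [norm_nonneg (u - x ^ 2)]
  have hdist : (x.re - x₀) ^ 2 + x.im ^ 2 ≤ 4 := by
    have h1 : ‖x - x₀‖ ≤ 2 := by
      refine (norm_sub_le _ _).trans ?_
      rw [Complex.norm_real, Real.norm_eq_abs]
      linarith
    have h2 : ‖x - x₀‖ ^ 2 ≤ 2 ^ 2 := by gcongr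
    rw [Complex.sq_norm, Complex.normSq_apply] at h2
    simp at h2
    linarith
  -- With `x - x₀ = α + iβ` the left side is `1 - (α² - β²)/2 + (α² + β²)²/16`; `hdist` bounds the
  -- last term by `(α² + β²)/4`.
  have hB : ‖1 - (x - x₀) ^ 2 / 4‖ ^ 2 ≤ 1 - (x.re - x₀) ^ 2 / 4 + 3 * x.im ^ 2 / 4 := by
    have h3 : (x - x₀) ^ 2 / 4 = (((x.re - x₀) ^ 2 - x.im ^ 2) / 4 : ℝ)
        + ((x.re - x₀) * x.im / 2 : ℝ) * Complex.I := by
      apply Complex.ext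
      · simp [pow_two]
      · simp [pow_two]
        ring
    rw [h3, Complex.sq_norm, Complex.normSq_apply]
    simp only [Complex.sub_re, Complex.one_re, Complex.add_re, Complex.ofReal_re, Complex.mul_re,
      Complex.I_re, Complex.ofReal_im, Complex.I_im, Complex.sub_im, Complex.one_im, Complex.add_im,
      Complex.mul_im]
    generalize x.re - x₀ = α at hdist ⊢
    nlinarith [mul_nonneg (sub_nonneg.2 hdist) (add_nonneg (sq_nonneg α) (sq_nonneg x.im))]
  have hpos : 0 < (x.re - x₀) ^ 2 + x.im ^ 2 := by
    by_contra hcon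
    have h4 : x.re - x₀ = 0 := by nlinarith [sq_nonneg (x.re - x₀), sq_nonneg x.im]
    have h5 : x.im = 0 := by nlinarith [sq_nonneg (x.re - x₀), sq_nonneg x.im]
    exact hx (Complex.ext (by simpa using sub_eq_zero.1 h4) (by simpa using h5))
  refine (sq_lt_one_iff₀ (norm_nonneg _)).1 ?_
  rw [norm_mul, mul_pow]
  have hd1 : 0 ≤ 1 - x.im ^ 2 := (sq_nonneg _).trans hA
  calc _ ≤ (1 - x.im ^ 2) * (1 - (x.re - x₀) ^ 2 / 4 + 3 * x.im ^ 2 / 4) :=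
        mul_le_mul hA hB (sq_nonneg _) hd1
    _ < 1 := by
      -- With `c = (Re x - x₀)²` and `d = (Im x)²` the product is `1 - c(1 - d)/4 - d/4 - 3d²/4`,
      -- and `c + d > 0`.
      have hc := sq_nonneg (x.re - x₀)
      have hd := sq_nonneg x.im
      generalize (x.re - x₀) ^ 2 = c at *
      generalize x.im ^ 2 = d at *
      rcases hd.eq_or_lt with rfl | hd
      · nlinarith
      · nlinarith [mul_nonneg hd1 hc, mul_pos hd hd]

end Elementary

open scoped ComplexConjugate

/-! ### The symmetrised bidisc. -/

section SymmetrisedBidisc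

/-- For a square root `ω` of `p`, the relation `s = conj s * p` says that `conj ω * s` is real. -/
lemma exists_param_of_eq_conj_mul {s p : ℂ} (hs : ‖s‖ ≤ 2) (hp : ‖p‖ = 1) (h : s = conj s * p) :
    ∃ (ω : ℂ) (x : ℝ), ‖ω‖ = 1 ∧ |x| ≤ 1 ∧ s = 2 * ω * x ∧ p = ω ^ 2 := by
  obtain ⟨ω, hω⟩ := IsAlgClosed.exists_pow_nat_eq p (n := 2) two_pos
  have hω1 : ‖ω‖ = 1 := by
    rw [← hω, norm_pow] at hp
    exact (pow_eq_one_iff_of_nonneg (norm_nonneg _) two_ne_zero).1 hp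
  have hc : ω * conj ω = 1 := by rw [Complex.mul_conj']; simp [hω1]
  obtain ⟨x, hx⟩ := Complex.conj_eq_iff_real.1 (show conj (conj ω * s / 2) = conj ω * s / 2 by
    simp only [map_div₀, map_mul, Complex.conj_conj, map_ofNat]
    rw [← hω] at h
    linear_combination (-1 / 2 * conj ω) * h - conj s * ω / 2 * hc)
  refine ⟨ω, x, hω1, ?_, ?_, hω.symm⟩
  · have : ‖conj ω * s / 2‖ = |x| := by rw [hx, Complex.norm_real, Real.norm_eq_abs]
    rw [← this]
    simp [hω1]
    linarith
  · rw [← hx]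
    linear_combination (-s) * hc

lemma param_mem_symTorus {ω : ℂ} {x : ℝ} (hω : ‖ω‖ = 1) (hx : |x| ≤ 1) :
    (2 * ω * x, ω ^ 2) ∈ symTorus := by
  have hx2 : x ^ 2 ≤ 1 := (sq_le_one_iff_abs_le_one x).2 hx
  have hy : √(1 - x ^ 2) ^ 2 = 1 - x ^ 2 := Real.sq_sqrt (by linarith)
  -- The two unimodular roots are `ω(x ± iy)`.
  set y := √(1 - x ^ 2)
  have hn : ∀ y : ℝ, y ^ 2 = 1 - x ^ 2 → ‖ω * (x + y * Complex.I)‖ = 1 := by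
    intro y hy
    rw [norm_mul, hω, one_mul, Complex.norm_add_mul_I, Real.sqrt_eq_one]
    linarith
  refine ⟨ω * (x + y * Complex.I), ω * (x + (-y : ℝ) * Complex.I), hn _ hy, hn _ (by simpa), ?_⟩
  have hy' : (y : ℂ) ^ 2 = 1 - x ^ 2 := mod_cast hy
  refine Prod.ext ?_ ?_
  · push_cast
    ring
  · push_cast
    linear_combination (-ω ^ 2) * hy' + ω ^ 2 * y ^ 2 * Complex.I_sq

lemma mem_symTorus_iff {s p : ℂ} :
    (s, p) ∈ symTorus ↔ ‖s‖ ≤ 2 ∧ ‖p‖ = 1 ∧ s = conj s * p := by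
  constructor
  · rintro ⟨z, w, hz, hw, h⟩
    obtain ⟨rfl, rfl⟩ := Prod.mk.inj h
    have hz' : z * conj z = 1 := by rw [Complex.mul_conj']; simp [hz]
    have hw' : w * conj w = 1 := by rw [Complex.mul_conj']; simp [hw]
    refine ⟨(norm_add_le _ _).trans (by rw [hz, hw]; norm_num), by rw [norm_mul, hz, hw, one_mul],
      ?_⟩
    rw [map_add]
    linear_combination (-w) * hz' - z * hw'
  · rintro ⟨hs, hp, h⟩
    obtain ⟨ω, x, hω, hx, rfl, rfl⟩ := exists_param_of_eq_conj_mul hs hp h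
    exact param_mem_symTorus hω hx

lemma exists_param_of_mem_symTorus {s p : ℂ} (h : (s, p) ∈ symTorus) :
    ∃ (ω : ℂ) (x : ℝ), ‖ω‖ = 1 ∧ |x| ≤ 1 ∧ s = 2 * ω * x ∧ p = ω ^ 2 :=
  let ⟨h1, h2, h3⟩ := mem_symTorus_iff.1 h
  exists_param_of_eq_conj_mul h1 h2 h3

lemma isCompact_symTorus : IsCompact symTorus := by
  have : symTorus = (fun q : ℂ × ℂ => (q.1 + q.2, q.1 * q.2)) '' (sphere 0 1 ×ˢ sphere 0 1) := by
    ext x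
    simp [symTorus, eq_comm, and_assoc]
  rw [this]
  exact ((isCompact_sphere _ _).prod (isCompact_sphere _ _)).image (by fun_prop)

lemma mem_closure_symBidisc {z w : ℂ} (hz : ‖z‖ ≤ 1) (hw : ‖w‖ ≤ 1) :
    (z + w, z * w) ∈ closure symBidisc := by
  have h : (z, w) ∈ closure (ball (0 : ℂ) 1 ×ˢ ball (0 : ℂ) 1) := by
    rw [closure_prod_eq, closure_ball _ one_ne_zero]
    simp [hz, hw]
  refine map_mem_closure (f := fun q : ℂ × ℂ => (q.1 + q.2, q.1 * q.2)) (by fun_prop) h ?_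
  rintro ⟨z, w⟩ ⟨hz, hw⟩
  exact ⟨z, w, by simpa using hz, by simpa using hw, rfl⟩

/-- At `(z + w, zw)` the left side is `|(z + w)/2|² + |(z - w)/2|² = (|z|² + |w|²)/2`. -/
lemma norm_sq_add_le_of_mem_closure_symBidisc {x : ℂ × ℂ} (hx : x ∈ closure symBidisc) :
    ‖x.1 / 2‖ ^ 2 + ‖x.2 - (x.1 / 2) ^ 2‖ ≤ 1 := by
  have hcl : IsClosed {x : ℂ × ℂ | ‖x.1 / 2‖ ^ 2 + ‖x.2 - (x.1 / 2) ^ 2‖ ≤ 1} :=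
    isClosed_le (by fun_prop) continuous_const
  refine closure_minimal ?_ hcl hx
  rintro _ ⟨z, w, hz, hw, rfl⟩
  have h1 : z * w - ((z + w) / 2) ^ 2 = -((z - w) / 2) ^ 2 := by ring
  simp only [mem_ofPred_eq]
  rw [h1, norm_neg, norm_pow]
  have hpar := parallelogram_law_with_norm ℝ z w
  have hz2 := pow_le_one₀ (n := 2) (norm_nonneg z) hz.le
  have hw2 := pow_le_one₀ (n := 2) (norm_nonneg w) hw.le
  simp only [norm_div, Complex.norm_ofNat]
  nlinarith

/-- The rotation `(s, p) ↦ (conj ω * s, conj ω ^ 2 * p)` reduces the claim to `norm_peak_mul_lt`. -/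
lemma isPeakPoint_symBidisc_of_mem_symTorus {u : ℂ × ℂ} (hu : u ∈ symTorus) :
    IsPeakPoint symBidisc u := by
  refine ⟨?_, ?_⟩
  · obtain ⟨z, w, hz, hw, rfl⟩ := hu
    exact mem_closure_symBidisc hz.le hw.le
  obtain ⟨s₀, p₀⟩ := u
  obtain ⟨ω, x₀, hω, hx₀, rfl, rfl⟩ := exists_param_of_mem_symTorus hu
  have hc : ω * conj ω = 1 := by rw [Complex.mul_conj']; simp [hω]
  let g : ℂ × ℂ → ℂ := fun x =>
    (1 + conj ω ^ 2 * x.2) / 2 * (1 - (conj ω * (x.1 / 2) - x₀) ^ 2 / 4)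
  have hg : Differentiable ℂ g := by fun_prop
  refine ⟨g, ⟨hg.continuous.continuousOn, hg.differentiableOn⟩, ?_, ?_⟩
  · have h1 : conj ω ^ 2 * ω ^ 2 = 1 := by rw [← mul_pow, mul_comm, hc, one_pow]
    have h2 : conj ω * (2 * ω * x₀ / 2) - x₀ = 0 := by linear_combination x₀ * hc
    simp only [g, h1, h2]
    norm_num
  · rintro ⟨s, p⟩ ⟨hx, hne⟩
    have hle := norm_sq_add_le_of_mem_closure_symBidisc hx
    refine norm_peak_mul_lt hx₀ ?_ ?_
    · have h1 : conj ω ^ 2 * p - (conj ω * (s / 2)) ^ 2 = conj ω ^ 2 * (p - (s / 2) ^ 2) := by ring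
      simp only
      rw [h1, norm_mul, norm_mul, norm_pow, RCLike.norm_conj, hω]
      simpa using hle
    · rintro ⟨h1, h2⟩
      refine hne (Prod.ext ?_ ?_)
      · simp only at h1 ⊢
        linear_combination (2 * ω) * h1 - s * hc
      · simp only at h2 ⊢
        linear_combination ω ^ 2 * h2 - p * (ω * conj ω + 1) * hc

lemma symTorus_mem_closedBoundaries : symTorus ∈ closedBoundaries symBidisc := by
  refine mem_closedBoundaries_of_norm_le isCompact_symTorus
    ⟨(1 + 1, 1 * 1), 1, 1, by simp, by simp, rfl⟩
    (fun u hu => (isPeakPoint_symBidisc_of_mem_symTorus hu).1) Subset.rfl subset_closure ?_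
  rintro f hf M hM _ ⟨z, w, hz, hw, rfl⟩
  refine norm_le_of_norm_le_on_torus (g := fun q => f (q.1 + q.2, q.1 * q.2)) ?_ ?_ ?_ hz.le hw.le
  · refine hf.1.comp (g := f) (by fun_prop) ?_
    rintro ⟨z, w⟩ ⟨hz, hw⟩
    exact mem_closure_symBidisc (by simpa using hz) (by simpa using hw)
  · refine hf.2.comp (g := f) (by fun_prop) ?_
    rintro ⟨z, w⟩ ⟨hz, hw⟩
    exact ⟨z, w, by simpa using hz, by simpa using hw, rfl⟩
  · exact fun z w hz hw => hM _ ⟨z, w, hz, hw, rfl⟩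

lemma distinguishedBoundary_symBidisc : distinguishedBoundary symBidisc = symTorus :=
  distinguishedBoundary_eq_of_isPeakPoint symTorus_mem_closedBoundaries
    fun _ => isPeakPoint_symBidisc_of_mem_symTorus

end SymmetrisedBidisc

open scoped Matrix.Norms.L2Operator ComplexOrder

/-! ### Contractions, unitaries and singular values. -/

section Contractions

variable {A : Matrix (Fin 2) (Fin 2) ℂ}

lemma norm_sq_col_le_one (hA : ‖A‖ ≤ 1) (j : Fin 2) : ‖A 0 j‖ ^ 2 + ‖A 1 j‖ ^ 2 ≤ 1 := by
  have h := (toEuclideanCLM (n := Fin 2) (𝕜 := ℂ) A).le_opNorm (PiLp.single 2 j (1 : ℂ))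
  rw [l2_opNorm_toEuclideanCLM, PiLp.norm_single, norm_one, mul_one] at h
  have h2 := pow_le_one₀ (n := 2) (norm_nonneg _) (h.trans hA)
  rw [EuclideanSpace.norm_sq_eq, Fin.sum_univ_two] at h2
  simpa using h2

lemma norm_sq_row_le_one (hA : ‖A‖ ≤ 1) (i : Fin 2) : ‖A i 0‖ ^ 2 + ‖A i 1‖ ^ 2 ≤ 1 := by
  simpa using norm_sq_col_le_one ((l2_opNorm_conjTranspose A).trans_le hA) i

/-- The entry `A 1 0` lies in both the first column and the second row; average their bounds and use
the parallelogram law on the diagonal. -/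
lemma pentaMap_norm_sq_add_le (hA : ‖A‖ ≤ 1) :
    ‖(pentaMap A).1‖ ^ 2 + ‖(pentaMap A).2.1 / 2‖ ^ 2 ≤ 1 := by
  have h1 := norm_sq_col_le_one hA 0
  have h2 := norm_sq_row_le_one hA 1
  have hpar := parallelogram_law_with_norm ℝ (A 0 0) (A 1 1)
  simp only [pentaMap, trace_fin_two, norm_div, Complex.norm_ofNat]
  nlinarith [norm_nonneg (A 0 0 - A 1 1)]

lemma norm_det_le_one (hA : ‖A‖ ≤ 1) : ‖A.det‖ ≤ 1 := by
  have h1 := norm_sq_col_le_one hA 0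
  have h2 := norm_sq_col_le_one hA 1
  rw [det_fin_two]
  refine (norm_sub_le _ _).trans ?_
  rw [norm_mul, norm_mul]
  nlinarith [sq_nonneg (‖A 0 0‖ - ‖A 1 1‖), sq_nonneg (‖A 0 1‖ - ‖A 1 0‖)]

lemma pentaMap_smul (c : ℂ) (A : Matrix (Fin 2) (Fin 2) ℂ) :
    pentaMap (c • A) = (c * (pentaMap A).1, c * (pentaMap A).2.1, c ^ 2 * (pentaMap A).2.2) := by
  simp [pentaMap]

lemma smul_mem_pentablock (hA : ‖A‖ ≤ 1) {r : ℝ} (hr : r ∈ Ico (0 : ℝ) 1) :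
    pentaMap ((r : ℂ) • A) ∈ pentablock := by
  refine ⟨_, ?_, rfl⟩
  change ‖(r : ℂ) • A‖ < 1
  rw [norm_smul, Complex.norm_of_nonneg hr.1]
  nlinarith [hr.1, hr.2, norm_nonneg A]

lemma continuous_pentaMap : Continuous pentaMap := by
  unfold pentaMap
  fun_prop

lemma pentaMap_mem_closure (hA : ‖A‖ ≤ 1) : pentaMap A ∈ closure pentablock := by
  have hA' : A ∈ closure (ball (0 : Matrix (Fin 2) (Fin 2) ℂ) 1) := by
    rw [closure_ball _ one_ne_zero]
    simpa using hA
  refine map_mem_closure continuous_pentaMap hA' fun B hB => ⟨B, ?_, rfl⟩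
  change ‖B‖ < 1
  simpa using hB

lemma bounds_of_mem_closure_pentablock {x : ℂ × ℂ × ℂ} (hx : x ∈ closure pentablock) :
    ‖x.1‖ ^ 2 + ‖x.2.1 / 2‖ ^ 2 ≤ 1 ∧ ‖x.2.2‖ ≤ 1 := by
  have hcl : IsClosed {x : ℂ × ℂ × ℂ | ‖x.1‖ ^ 2 + ‖x.2.1 / 2‖ ^ 2 ≤ 1 ∧ ‖x.2.2‖ ≤ 1} :=
    IsClosed.and (isClosed_le (by fun_prop) continuous_const)
      (isClosed_le (by fun_prop) continuous_const)
  refine closure_minimal ?_ hcl hx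
  rintro _ ⟨A, hA, rfl⟩
  have hA' : ‖A‖ ≤ 1 := le_of_lt hA
  exact ⟨pentaMap_norm_sq_add_le hA', norm_det_le_one hA'⟩

lemma norm_eq_one_of_mem_unitaryGroup (hA : A ∈ unitaryGroup (Fin 2) ℂ) : ‖A‖ = 1 :=
  CStarRing.norm_of_mem_unitary hA

lemma pentaMap_unitary_mem_symTorus (hA : A ∈ unitaryGroup (Fin 2) ℂ) :
    ((pentaMap A).2.1, (pentaMap A).2.2) ∈ symTorus := by
  have hdet : ‖A.det‖ = 1 := CStarRing.norm_of_mem_unitary (det_of_mem_unitary hA)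
  refine mem_symTorus_iff.2 ⟨?_, hdet, ?_⟩
  · have h := pentaMap_norm_sq_add_le (norm_eq_one_of_mem_unitaryGroup hA).le
    rw [norm_div, Complex.norm_ofNat] at h
    nlinarith [norm_nonneg (pentaMap A).2.1, sq_nonneg ‖(pentaMap A).1‖]
  -- A `2 × 2` matrix and its adjugate have equal traces, so tracing this identity gives `s = conj s
  -- * p`.
  · have hadj : A.adjugate = A.det • Aᴴ := by
      calc A.adjugate = A.adjugate * (A * Aᴴ) := by
            rw [show A * Aᴴ = 1 from mem_unitaryGroup_iff.1 hA, mul_one]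
        _ = A.det • Aᴴ := by rw [← mul_assoc, adjugate_mul, smul_mul_assoc, one_mul]
    have htr : A.adjugate.trace = A.trace := by
      simp [adjugate_fin_two, trace_fin_two, add_comm]
    change A.trace = conj A.trace * A.det
    calc A.trace = (A.det • Aᴴ).trace := by rw [← hadj, htr]
      _ = conj A.trace * A.det := by
          rw [trace_smul, trace_conjTranspose, smul_eq_mul, mul_comm]
          rfl

lemma exists_unitary_pentaMap_eq {b s p : ℂ} (h : (s, p) ∈ symTorus)
    (hb : ‖b‖ ^ 2 + ‖s / 2‖ ^ 2 ≤ 1) :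
    ∃ A ∈ unitaryGroup (Fin 2) ℂ, pentaMap A = (b, s, p) := by
  obtain ⟨ω, x, hω, hx, rfl, rfl⟩ := exists_param_of_mem_symTorus h
  have hc : ω * conj ω = 1 := by rw [Complex.mul_conj']; simp [hω]
  have hb' : ‖b‖ ^ 2 + x ^ 2 ≤ 1 := by
    rw [show 2 * ω * x / 2 = ω * x by ring, norm_mul, hω, one_mul, Complex.norm_real,
      Real.norm_eq_abs, sq_abs] at hb
    exact hb
  -- `y` is chosen to give the rows of the matrix below unit length.
  obtain ⟨y, hy⟩ : ∃ y : ℝ, y ^ 2 = 1 - ‖b‖ ^ 2 - x ^ 2 := ⟨_, Real.sq_sqrt (by linarith)⟩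
  have hy' : (y : ℂ) ^ 2 = 1 - b * conj b - x ^ 2 := by
    rw [Complex.mul_conj']
    exact_mod_cast hy
  have hI := Complex.I_sq
  refine ⟨!![ω * (x + y * Complex.I), -ω ^ 2 * conj b; b, ω * (x - y * Complex.I)], ?_, ?_⟩
  · rw [mem_unitaryGroup_iff, star_eq_conjTranspose]
    ext i j
    fin_cases i <;> fin_cases j <;>
      simp [Matrix.mul_apply, Fin.sum_univ_two]
    · linear_combination (x ^ 2 + y ^ 2 + b * conj b * (1 + ω * conj ω)) * hc
        - ω * conj ω * y ^ 2 * hI + hy'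
    · linear_combination (-ω * conj b * (x + y * Complex.I)) * hc
    · linear_combination (-conj ω * b * (x - y * Complex.I)) * hc
    · linear_combination (x ^ 2 + y ^ 2) * hc - ω * conj ω * y ^ 2 * hI + hy'
  · refine Prod.ext (by simp [pentaMap]) (Prod.ext ?_ ?_)
    · simp [pentaMap, trace_fin_two]
      ring
    · simp [pentaMap, det_fin_two]
      linear_combination ω ^ 2 * hy' - ω ^ 2 * y ^ 2 * hI

/-- The singular value decomposition of an invertible contraction. -/
lemma exists_singular_value_decomposition (hA : ‖A‖ ≤ 1) (hdet : A.det ≠ 0) :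
    ∃ U ∈ unitaryGroup (Fin 2) ℂ, ∃ V ∈ unitaryGroup (Fin 2) ℂ, ∃ z w : ℂ,
      ‖z‖ ≤ 1 ∧ ‖w‖ ≤ 1 ∧ A = U * diagonal ![z, w] * V := by
  have hH := isHermitian_conjTranspose_mul_self A
  set e := hH.eigenvalues with he
  have hepos : ∀ i, 0 < e i := by
    intro i
    refine lt_of_le_of_ne ((posSemidef_conjTranspose_mul_self A).eigenvalues_nonneg i) fun h0 => ?_
    have h1 := hH.det_eq_prod_eigenvalues
    rw [Finset.prod_eq_zero (Finset.mem_univ i) (by simp [← he, ← h0]), det_mul,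
      det_conjTranspose] at h1
    simp [hdet] at h1
  let W : Matrix (Fin 2) (Fin 2) ℂ := hH.eigenvectorUnitary
  have hW : W ∈ unitaryGroup (Fin 2) ℂ := hH.eigenvectorUnitary.2
  have hW1 : Wᴴ * W = 1 := mem_unitaryGroup_iff'.1 hW
  have hW2 : W * Wᴴ = 1 := mem_unitaryGroup_iff.1 hW
  have hspec : Aᴴ * A = W * diagonal (fun i => (e i : ℂ)) * Wᴴ := by
    have := hH.spectral_theorem
    rw [Unitary.conjStarAlgAut_apply] at this
    exact this
  have hspec' : Wᴴ * (Aᴴ * A) * W = diagonal (fun i => (e i : ℂ)) := by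
    rw [hspec]
    calc _ = (Wᴴ * W) * diagonal (fun i => (e i : ℂ)) * (Wᴴ * W) := by simp only [mul_assoc]
      _ = _ := by rw [hW1, one_mul, mul_one]
  let d : Fin 2 → ℂ := fun i => (√(e i) : ℂ)
  have hd : ∀ i, d i ≠ 0 := fun i => by simpa [d] using (Real.sqrt_pos.2 (hepos i)).ne'
  have hd2 : ∀ i, d i * d i = e i := fun i => by
    simp only [d]
    exact_mod_cast Real.mul_self_sqrt (hepos i).le
  -- By `hspec'` the columns of `A * W` are orthogonal with lengths `d i`, nonzero because `A` is
  -- invertible.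
  let U := A * W * diagonal (fun i => (d i)⁻¹)
  have hUd : U * diagonal d = A * W := by
    simp [U, mul_assoc, diagonal_mul_diagonal, hd]
  have hstar : (diagonal fun i => (d i)⁻¹)ᴴ = diagonal (fun i => (d i)⁻¹) := by
    rw [diagonal_conjTranspose]
    congr 1
    ext i
    simp [d]
  have hU : U ∈ unitaryGroup (Fin 2) ℂ := by
    rw [mem_unitaryGroup_iff', star_eq_conjTranspose]
    calc Uᴴ * U = diagonal (fun i => (d i)⁻¹) * (Wᴴ * (Aᴴ * A) * W) *
          diagonal (fun i => (d i)⁻¹) := by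
          simp only [U, conjTranspose_mul, hstar, mul_assoc]
      _ = 1 := by
          rw [hspec', diagonal_mul_diagonal, diagonal_mul_diagonal, ← diagonal_one]
          congr 1
          ext i
          rw [← hd2]
          field_simp [hd i]
  have hU1 : Uᴴ * U = 1 := mem_unitaryGroup_iff'.1 hU
  have hnorm : ‖d‖ ≤ 1 := by
    rw [← l2_opNorm_diagonal]
    calc ‖diagonal d‖ = ‖Uᴴ * A * W‖ := by
          rw [mul_assoc, ← hUd, ← mul_assoc, hU1, one_mul]
      _ ≤ ‖Uᴴ‖ * ‖A‖ * ‖W‖ := (norm_mul_le _ _).trans (by gcongr; exact norm_mul_le _ _)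
      _ ≤ 1 := by
          rw [l2_opNorm_conjTranspose, norm_eq_one_of_mem_unitaryGroup hU,
            norm_eq_one_of_mem_unitaryGroup hW]
          simpa using hA
  refine ⟨U, hU, Wᴴ, Unitary.star_mem hW, d 0, d 1,
    (norm_le_pi_norm d 0).trans hnorm, (norm_le_pi_norm d 1).trans hnorm, ?_⟩
  have hd' : ![d 0, d 1] = d := by
    ext i
    fin_cases i <;> rfl
  rw [hd', hUd, mul_assoc, hW2, mul_one]

end Contractions

/-! ### The pentablock. -/

section Pentablock

lemma mem_pentaK₀_iff {x : ℂ × ℂ × ℂ} :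
    x ∈ pentaK₀ ↔ (x.2.1, x.2.2) ∈ symTorus ∧ ‖x.1‖ = √(1 - (1 / 4) * ‖x.2.1‖ ^ 2) := by
  rw [pentaK₀, distinguishedBoundary_symBidisc]
  rfl

lemma sq_sqrt_of_mem_symTorus {s p : ℂ} (h : (s, p) ∈ symTorus) :
    √(1 - (1 / 4) * ‖s‖ ^ 2) ^ 2 + ‖s / 2‖ ^ 2 = 1 := by
  have hs := (mem_symTorus_iff.1 h).1
  rw [Real.sq_sqrt (by nlinarith [norm_nonneg s]), norm_div, Complex.norm_ofNat]
  ring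

lemma norm_sq_add_eq_one_of_mem_pentaK₀ {x : ℂ × ℂ × ℂ} (hx : x ∈ pentaK₀) :
    ‖x.1‖ ^ 2 + ‖x.2.1 / 2‖ ^ 2 = 1 := by
  obtain ⟨h1, h2⟩ := mem_pentaK₀_iff.1 hx
  rw [h2, sq_sqrt_of_mem_symTorus h1]

lemma pentaK₀_subset_closure : pentaK₀ ⊆ closure pentablock := by
  intro x hx
  obtain ⟨A, hA, h⟩ := exists_unitary_pentaMap_eq (mem_pentaK₀_iff.1 hx).1
    (norm_sq_add_eq_one_of_mem_pentaK₀ hx).le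
  rw [show x = pentaMap A from h.symm]
  exact pentaMap_mem_closure (norm_eq_one_of_mem_unitaryGroup hA).le

lemma isCompact_pentaK₀ : IsCompact pentaK₀ := by
  refine ((isCompact_closedBall (0 : ℂ) 1).prod isCompact_symTorus).of_isClosed_subset ?_ ?_
  · have h : pentaK₀ = {x | (x.2.1, x.2.2) ∈ symTorus} ∩
        {x | ‖x.1‖ = √(1 - (1 / 4) * ‖x.2.1‖ ^ 2)} := by
      ext x
      exact mem_pentaK₀_iff
    rw [h]
    exact (isCompact_symTorus.isClosed.preimage (by fun_prop)).inter
      (isClosed_eq (by fun_prop) (by fun_prop))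
  · intro x hx
    refine ⟨?_, (mem_pentaK₀_iff.1 hx).1⟩
    rw [mem_closedBall_zero_iff, ← sq_le_one_iff₀ (norm_nonneg _),
      ← norm_sq_add_eq_one_of_mem_pentaK₀ hx]
    exact le_add_of_nonneg_right (sq_nonneg _)

/-- The equality case of the Cauchy–Schwarz inequality in the unit ball of `ℂ²`. -/
lemma eq_of_conj_mul_add_conj_mul_eq_one {a b a₀ b₀ : ℂ} (h₀ : ‖a₀‖ ^ 2 + ‖b₀‖ ^ 2 = 1)
    (h : ‖a‖ ^ 2 + ‖b‖ ^ 2 ≤ 1) (heq : conj a₀ * a + conj b₀ * b = 1) : a = a₀ ∧ b = b₀ := by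
  have hre := congrArg Complex.re heq
  simp only [Complex.sq_norm, Complex.normSq_apply] at h₀ h
  simp at hre
  -- The squared distance is at most `1 + 1 - 2 Re(conj a₀ * a + conj b₀ * b) = 0`.
  have key : (a.re - a₀.re) ^ 2 + (a.im - a₀.im) ^ 2 + (b.re - b₀.re) ^ 2 + (b.im - b₀.im) ^ 2
      ≤ 0 := by nlinarith
  have h1 := sq_nonneg (a.re - a₀.re)
  have h2 := sq_nonneg (a.im - a₀.im)
  have h3 := sq_nonneg (b.re - b₀.re)
  have h4 := sq_nonneg (b.im - b₀.im)
  have aux : ∀ y : ℝ, y ^ 2 ≤ 0 → y = 0 := fun y hy => pow_eq_zero_iff two_ne_zero |>.1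
    (hy.antisymm (sq_nonneg y))
  exact ⟨Complex.ext (sub_eq_zero.1 (aux _ (by linarith))) (sub_eq_zero.1 (aux _ (by linarith))),
    Complex.ext (sub_eq_zero.1 (aux _ (by linarith))) (sub_eq_zero.1 (aux _ (by linarith)))⟩

lemma norm_conj_mul_add_conj_mul_le_one {a b a₀ b₀ : ℂ} (h₀ : ‖a₀‖ ^ 2 + ‖b₀‖ ^ 2 = 1)
    (h : ‖a‖ ^ 2 + ‖b‖ ^ 2 ≤ 1) : ‖conj a₀ * a + conj b₀ * b‖ ≤ 1 := by
  refine (norm_add_le _ _).trans ?_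
  simp only [norm_mul, RCLike.norm_conj]
  nlinarith [sq_nonneg (‖a₀‖ - ‖a‖), sq_nonneg (‖b₀‖ - ‖b‖)]

/-- The factor with `ℓ`, the inner product with `(a₀, s₀/2)`, has modulus one only at `a = a₀`, `s =
s₀`; the other factor then forces `p = p₀`. -/
lemma isPeakPoint_of_mem_pentaK₀ {u : ℂ × ℂ × ℂ} (hu : u ∈ pentaK₀) :
    IsPeakPoint pentablock u := by
  refine ⟨pentaK₀_subset_closure hu, ?_⟩
  have h₀ := norm_sq_add_eq_one_of_mem_pentaK₀ hu
  have hp := (mem_symTorus_iff.1 (mem_pentaK₀_iff.1 hu).1).2.1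
  obtain ⟨a₀, s₀, p₀⟩ := u
  simp only at h₀ hp
  have hpc : p₀ * conj p₀ = 1 := by rw [Complex.mul_conj']; simp [hp]
  let ℓ : ℂ × ℂ × ℂ → ℂ := fun x => conj a₀ * x.1 + conj (s₀ / 2) * (x.2.1 / 2)
  let g : ℂ × ℂ × ℂ → ℂ := fun x => (1 + ℓ x) / 2 * ((1 + conj p₀ * x.2.2) / 2)
  have hg : Differentiable ℂ g := by fun_prop
  refine ⟨g, ⟨hg.continuous.continuousOn, hg.differentiableOn⟩, ?_, ?_⟩
  · have h1 : ℓ (a₀, s₀, p₀) = 1 := by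
      simp only [ℓ, Complex.conj_mul']
      exact_mod_cast h₀
    simp only [g, h1, mul_comm (conj p₀), hpc]
    norm_num
  · rintro ⟨a, s, p⟩ ⟨hx, hne⟩
    obtain ⟨hb, hple⟩ := bounds_of_mem_closure_pentablock hx
    have hℓ : ‖ℓ (a, s, p)‖ ≤ 1 := norm_conj_mul_add_conj_mul_le_one h₀ hb
    have hq : ‖conj p₀ * p‖ ≤ 1 := by simpa [hp] using hple
    simp only [g]
    rw [norm_mul]
    by_cases h1 : ℓ (a, s, p) = 1
    · obtain ⟨ha, hs⟩ := eq_of_conj_mul_add_conj_mul_eq_one h₀ hb h1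
      have hs : s = s₀ := by simpa using hs
      have hpne : conj p₀ * p ≠ 1 := fun h => hne (by
        refine Prod.ext ha (Prod.ext hs ?_)
        simp only
        linear_combination p₀ * h - p * hpc)
      exact mul_lt_one_of_nonneg_of_lt_one_right (norm_one_add_half_le hℓ) (norm_nonneg _)
        (norm_one_add_half_lt hq hpne)
    · exact mul_lt_one_of_nonneg_of_lt_one_left (norm_nonneg _) (norm_one_add_half_lt hℓ h1)
        (norm_one_add_half_le hq)

variable {f : ℂ × ℂ × ℂ → ℂ} {M : ℝ}

lemma norm_le_of_unitary (hf : f ∈ discAlgebra pentablock) (hM : ∀ x ∈ pentaK₀, ‖f x‖ ≤ M)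
    {A : Matrix (Fin 2) (Fin 2) ℂ} (hA : A ∈ unitaryGroup (Fin 2) ℂ) : ‖f (pentaMap A)‖ ≤ M := by
  have hmem := pentaMap_unitary_mem_symTorus hA
  have hle := pentaMap_norm_sq_add_le (norm_eq_one_of_mem_unitaryGroup hA).le
  generalize pentaMap A = x at hmem hle ⊢
  obtain ⟨a, s, p⟩ := x
  simp only at hmem hle
  have hR := sq_sqrt_of_mem_symTorus hmem
  have hK : ∀ b : ℂ, ‖b‖ = √(1 - (1 / 4) * ‖s‖ ^ 2) → ‖f (b, s, p)‖ ≤ M :=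
    fun b hb => hM _ (mem_pentaK₀_iff.2 ⟨hmem, hb⟩)
  have hR0 := Real.sqrt_nonneg (1 - (1 / 4) * ‖s‖ ^ 2)
  generalize √(1 - (1 / 4) * ‖s‖ ^ 2) = R at hR hK hR0
  have ha : ‖a‖ ≤ R := by
    refine le_of_sq_le_sq ?_ hR0
    linarith
  have hU : ∀ t : ℂ, ‖t‖ ≤ 1 → ∃ B : Matrix (Fin 2) (Fin 2) ℂ, ‖B‖ ≤ 1 ∧
      pentaMap B = (t * R, s, p) := by
    intro t ht
    have htR : ‖t * R‖ ^ 2 + ‖s / 2‖ ^ 2 ≤ 1 := by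
      have : ‖t * R‖ ≤ R := by
        rw [norm_mul, Complex.norm_of_nonneg hR0]
        exact mul_le_of_le_one_left hR0 ht
      have : ‖t * R‖ ^ 2 ≤ R ^ 2 := by gcongr
      linarith
    obtain ⟨B, hB, h⟩ := exists_unitary_pentaMap_eq hmem htR
    exact ⟨B, (norm_eq_one_of_mem_unitaryGroup hB).le, h⟩
  have key : ∀ t : ℂ, ‖t‖ ≤ 1 → ‖f (t * R, s, p)‖ ≤ M := by
    intro t ht
    -- Scaling a unitary preimage by `r < 1` moves the disc into `pentablock`, where `f` is
    -- holomorphic.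
    have := norm_le_of_norm_le_on_circle (M := M) (t := t)
      (G := fun q => f (q.1 * (q.2 * R), q.1 * s, (q.1 : ℂ) ^ 2 * p)) ?_ ?_ ?_ ht
    · simpa using this
    · refine hf.1.comp (g := f) (by fun_prop) ?_
      rintro ⟨r, t⟩ ⟨hr, ht⟩
      obtain ⟨B, hB, h⟩ := hU t (by simpa using ht)
      have hrB : ‖(r : ℂ) • B‖ ≤ 1 := by
        rw [norm_smul, Complex.norm_of_nonneg hr.1]
        exact mul_le_one₀ hr.2 (norm_nonneg _) hB
      have := pentaMap_mem_closure hrB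
      rwa [pentaMap_smul, h] at this
    · intro r hr
      refine hf.2.comp (g := f) (by dsimp only; fun_prop) ?_
      intro t ht
      obtain ⟨B, hB, h⟩ := hU t (by simpa using (mem_ball_zero_iff.1 ht).le)
      have := smul_mem_pentablock hB hr
      rwa [pentaMap_smul, h] at this
    · intro t ht
      have : ‖t * R‖ = R := by rw [norm_mul, ht, one_mul, Complex.norm_of_nonneg hR0]
      simpa using hK _ this
  -- For `R = 0` the disc is a single point, already in `pentaK₀`.
  rcases hR0.eq_or_lt with h0 | h0
  · rw [← h0] at ha
    exact hK a (by rw [← h0]; exact ha.antisymm (norm_nonneg _))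
  · have hne : (R : ℂ) ≠ 0 := by exact_mod_cast h0.ne'
    have := key (a / R) (by
      rw [norm_div, Complex.norm_of_nonneg hR0]
      exact div_le_one_of_le₀ ha hR0)
    rwa [div_mul_cancel₀ _ hne] at this

lemma norm_mul_diagonal_mul {U V : Matrix (Fin 2) (Fin 2) ℂ} (hU : U ∈ unitaryGroup (Fin 2) ℂ)
    (hV : V ∈ unitaryGroup (Fin 2) ℂ) (z w : ℂ) :
    ‖U * diagonal ![z, w] * V‖ ≤ max ‖z‖ ‖w‖ := by
  refine (norm_mul_le _ _).trans ?_
  rw [norm_eq_one_of_mem_unitaryGroup hV, mul_one]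
  refine (norm_mul_le _ _).trans ?_
  rw [norm_eq_one_of_mem_unitaryGroup hU, one_mul, l2_opNorm_diagonal]
  refine (pi_norm_le_iff_of_nonneg (le_max_of_le_left (norm_nonneg _))).2 fun i => ?_
  fin_cases i <;> simp

lemma diagonal_mem_unitaryGroup {z w : ℂ} (hz : ‖z‖ = 1) (hw : ‖w‖ = 1) :
    diagonal ![z, w] ∈ unitaryGroup (Fin 2) ℂ := by
  rw [mem_unitaryGroup_iff, star_eq_conjTranspose, diagonal_conjTranspose, diagonal_mul_diagonal,
    ← diagonal_one]
  congr 1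
  ext i
  fin_cases i
  · simp [Complex.mul_conj', hz]
  · simp [Complex.mul_conj', hw]

lemma norm_le_of_det_ne_zero (hf : f ∈ discAlgebra pentablock) (hM : ∀ x ∈ pentaK₀, ‖f x‖ ≤ M)
    {A : Matrix (Fin 2) (Fin 2) ℂ} (hA : ‖A‖ ≤ 1) (hdet : A.det ≠ 0) : ‖f (pentaMap A)‖ ≤ M := by
  obtain ⟨U, hU, V, hV, z, w, hz, hw, rfl⟩ := exists_singular_value_decomposition hA hdet
  have hdiff : Differentiable ℂ fun q : ℂ × ℂ => pentaMap (U * diagonal ![q.1, q.2] * V) := by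
    simp [pentaMap, trace_fin_two, det_fin_two, Matrix.mul_apply, Fin.sum_univ_two, Matrix.diagonal_apply]
    fun_prop
  refine norm_le_of_norm_le_on_torus
    (g := fun q : ℂ × ℂ => f (pentaMap (U * diagonal ![q.1, q.2] * V))) ?_ ?_ ?_ hz hw
  · refine hf.1.comp (g := f) hdiff.continuous.continuousOn ?_
    rintro ⟨z, w⟩ ⟨hz, hw⟩
    exact pentaMap_mem_closure ((norm_mul_diagonal_mul hU hV z w).trans
      (max_le (by simpa using hz) (by simpa using hw)))
  · refine hf.2.comp (g := f) hdiff.differentiableOn ?_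
    rintro ⟨z, w⟩ ⟨hz, hw⟩
    exact ⟨_, (norm_mul_diagonal_mul hU hV z w).trans_lt
      (max_lt (by simpa using hz) (by simpa using hw)), rfl⟩
  · exact fun z w hz hw =>
      norm_le_of_unitary hf hM (mul_mem (mul_mem hU (diagonal_mem_unitaryGroup hz hw)) hV)

/-- `det (A + t • 1)` is a monic quadratic in `t`, hence nonzero for small `t ≠ 0`. This disposes of
singular matrices, which the decomposition above excludes. -/
lemma pentablock_subset_closure_image_det_ne_zero :
    pentablock ⊆ closure (pentaMap '' {A | ‖A‖ < 1 ∧ A.det ≠ 0}) := by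
  rintro _ ⟨A, hA, rfl⟩
  have hA : ‖A‖ < 1 := hA
  have hcont : Continuous fun t : ℂ => A + t • (1 : Matrix (Fin 2) (Fin 2) ℂ) := by fun_prop
  have htend : Tendsto (fun t : ℂ => A + t • (1 : Matrix (Fin 2) (Fin 2) ℂ)) (𝓝[≠] 0) (𝓝 A) := by
    have h := hcont.tendsto 0
    simp only [zero_smul, add_zero] at h
    exact h.mono_left nhdsWithin_le_nhds
  refine mem_closure_of_tendsto ((continuous_pentaMap.tendsto A).comp htend) ?_
  have hlt : ∀ᶠ t in 𝓝[≠] (0 : ℂ), ‖A + t • (1 : Matrix (Fin 2) (Fin 2) ℂ)‖ < 1 :=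
    htend.norm.eventually_lt_const hA
  have hdet : ∀ᶠ t in 𝓝[≠] (0 : ℂ), (A + t • (1 : Matrix (Fin 2) (Fin 2) ℂ)).det ≠ 0 := by
    have hexp : ∀ t : ℂ, (A + t • (1 : Matrix (Fin 2) (Fin 2) ℂ)).det =
        A.det + t * (t + A.trace) := by
      intro t
      simp [det_fin_two, trace_fin_two]
      ring
    simp only [hexp]
    by_cases h0 : A.det = 0
    · have htr : ∀ᶠ t in 𝓝[≠] (0 : ℂ), t + A.trace ≠ 0 := by
        by_cases h1 : A.trace = 0
        · filter_upwards [self_mem_nhdsWithin] with t ht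
          simpa [h1] using ht
        · refine ((continuous_id.add continuous_const).tendsto' 0 A.trace (by simp)).mono_left
            nhdsWithin_le_nhds |>.eventually_ne h1
      filter_upwards [htr, self_mem_nhdsWithin] with t h1 h2
      rw [h0, zero_add]
      exact mul_ne_zero h2 h1
    · have hc : Continuous fun t : ℂ => A.det + t * (t + A.trace) := by fun_prop
      exact ((hc.tendsto' 0 A.det (by simp)).mono_left nhdsWithin_le_nhds).eventually_ne h0
  filter_upwards [hlt, hdet] with t h1 h2
  exact ⟨_, ⟨h1, h2⟩, rfl⟩

lemma pentaK₀_mem_closedBoundaries : pentaK₀ ∈ closedBoundaries pentablock := by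
  -- The witness `(0, 2, 1)` is the image of the identity matrix.
  refine mem_closedBoundaries_of_norm_le isCompact_pentaK₀ ⟨(0, 2, 1), mem_pentaK₀_iff.2 ⟨?_, ?_⟩⟩
    pentaK₀_subset_closure (S := pentaMap '' {A | ‖A‖ < 1 ∧ A.det ≠ 0}) ?_
    pentablock_subset_closure_image_det_ne_zero ?_
  · exact mem_symTorus_iff.2 ⟨by simp, by simp, by simp only [map_ofNat, mul_one]⟩
  · norm_num
  · exact image_mono fun A hA => hA.1
  · rintro f hf M hM _ ⟨A, hA, rfl⟩
    exact norm_le_of_det_ne_zero hf hM hA.1.le hA.2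

lemma distinguishedBoundary_pentablock : distinguishedBoundary pentablock = pentaK₀ :=
  distinguishedBoundary_eq_of_isPeakPoint pentaK₀_mem_closedBoundaries
    fun _ => isPeakPoint_of_mem_pentaK₀

end Pentablock

theorem mainTheorem3 :
    -- `𝔾` has a smallest closed boundary `bΓ`, which is the symmetrised torus
    (IsLeast (closedBoundaries symBidisc) (distinguishedBoundary symBidisc) ∧
      distinguishedBoundary symBidisc = symTorus) ∧
    -- `𝒫` has a smallest closed boundary `b𝒫`
    IsLeast (closedBoundaries pentablock) (distinguishedBoundary pentablock) ∧
    (∀ x : ℂ × ℂ × ℂ, List.TFAE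
      [x ∈ pentaK₀,
       IsPeakPoint pentablock x,
       x ∈ distinguishedBoundary pentablock]) ∧
    distinguishedBoundary pentablock =
      {x : ℂ × ℂ × ℂ | (x.2.1, x.2.2) ∈ distinguishedBoundary symBidisc ∧
        ‖x.1‖ = Real.sqrt (1 - (1 / 4) * ‖x.2.1‖ ^ 2)} ∧
    distinguishedBoundary pentablock =
      {x : ℂ × ℂ × ℂ | ‖x.2.1‖ ≤ 2 ∧ ‖x.2.2‖ = 1 ∧
        x.2.1 = (starRingEnd ℂ) x.2.1 * x.2.2 ∧
        ‖x.1‖ = Real.sqrt (1 - (1 / 4) * ‖x.2.1‖ ^ 2)} := by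
  have hle : ∀ {E : Type} [NormedAddCommGroup E] [NormedSpace ℂ E] {Ω : Set E},
      distinguishedBoundary Ω ∈ closedBoundaries Ω →
        IsLeast (closedBoundaries Ω) (distinguishedBoundary Ω) :=
    fun h => ⟨h, fun _ hC => sInter_subset_of_mem hC⟩
  refine ⟨⟨hle ?_, distinguishedBoundary_symBidisc⟩, hle ?_, fun x => ?_,
    distinguishedBoundary_pentablock, ?_⟩
  · rw [distinguishedBoundary_symBidisc]
    exact symTorus_mem_closedBoundaries
  · rw [distinguishedBoundary_pentablock]
    exact pentaK₀_mem_closedBoundaries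
  · tfae_have 1 → 2 := isPeakPoint_of_mem_pentaK₀
    tfae_have 2 → 3 := fun h => mem_sInter.2 fun _ hC => h.mem_of_isBoundaryFor hC.2
    tfae_have 3 → 1 := fun h => distinguishedBoundary_pentablock ▸ h
    tfae_finish
  · rw [distinguishedBoundary_pentablock]
    ext x
    rw [mem_pentaK₀_iff, mem_symTorus_iff, and_assoc, and_assoc]
    rfl
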